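/- Let $H\in(1/2,1)$, $\phi(s,t)=H(2H-1)|s-t|^{2H-2}$, and let $L^2_\phi(\mathbb R)$ be the set of measurable $g:\mathbb R\to\mathbb R$ for which $\int_{\mathbb R}\int_{\mathbb R}\phi(s,t)g(s)g(t)\,ds\,dt$ converges absolutely. For $g\in L^2_\phi(\mathbb R)$ put $(\Phi g)(t)=\int_0^\infty\phi(t,u)g(u)\,du$. Let $B^H=(B^H_t)_{t\ge 0}$ be a fractional Brownian motion with Hurst parameter $H$ and continuous paths on a probability space $(\Omega,\mathcal F,P)$, i.e. a centered Gaussian process with covariance $\frac12(s^{2H}+t^{2H}-|s-t|^{2H})$. For $1\le p<\infty$ and a measurable path functional $F$ with $F(B^H)\in L^p(P)$, the derivative $D_{\Phi g}F$ of $F$ in the direction $\Phi g$ is the limit in $L^p(P)$, as $\delta\to0$, of $\delta^{-1}\big[F\big(B^H+\delta\int_0^{\cdot}(\Phi g)(u)\,du\big)-F(B^H)\big]$, if it exists. $F$ is called $\phi$-differentiable, with $\phi$-derivative $(D^\phi_sF)_{s\ge0}$, if for every $g\in L^2_\phi(\mathbb R)$ almost surely $s\mapsto D^\phi_sF\,g(s)$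 is integrable on $(0,\infty)$ and $D_{\Phi g}F=\int_0^\infty D^\phi_sF\,g(s)\,ds$. A process $(F_t)_{t\ge 0}$ is $\phi$-differentiable if each $F_t$ is and $(s,t,\omega)\mapsto D^\phi_sF_t(\omega)$ is jointly measurable. Let $x_0\ge0$ and $\mu,\sigma\in\mathbb R$, and let $X_t=x_0\exp\big(\mu t+\sigma B^H_t-\tfrac12\sigma^2t^{2H}\big)$, $t\ge 0$, be the geometric fractional Brownian motion, i.e. the solution of $dX_t=\mu X_t\,dt+\sigma X_t\,dB^H_t$, $X_0=x_0$. Then, for every $1\le p<\infty$, the process $X$ is $\phi$-differentiable, with $$D^\phi_sX_t=\sigma H X_t\big[s^{2H-1}+(t-s)^{2H-1}\big]\qquad(0\le s\le t),$$ and $D^\phi_sX_t=\sigma HX_t\big[s^{2H-1}-(s-t)^{2H-1}\big]$ for $s\ge t$. The $\phi$-derivative is unique: for each $t$, any $\phi$-derivative of $X_t$ coincides, almost surely, with this one for almost every $s\ge0$. -/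

import Mathlib

open MeasureTheory ProbabilityTheory Filter Topology
open scoped NNReal ENNReal

noncomputable section

namespace FracBM

/-- The kernel `φ(s,t) = H (2H - 1) |s - t|^(2H-2)`. -/
def phi (H s t : ℝ) : ℝ := H * (2 * H - 1) * |s - t| ^ (2 * H - 2)

/-- Membership in `L²_φ(ℝ)`: `g` is measurable and the double integral
`∫∫ φ(s,t) g(s) g(t) ds dt` converges (as a Lebesgue integral, that is, absolutely). -/
structure MemL2Phi (H : ℝ) (g : ℝ → ℝ) : Prop where
  measurable : Measurable g
  integrable : Integrable (fun z : ℝ × ℝ => phi H z.1 z.2 * g z.1 * g z.2)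
    ((volume : Measure ℝ).prod volume)

/-- The operator `(Φ g)(t) = ∫_0^∞ φ(t,u) g(u) du`. -/
def Phi (H : ℝ) (g : ℝ → ℝ) (t : ℝ) : ℝ := ∫ u in Set.Ioi (0 : ℝ), phi H t u * g u

/-- The path `t ↦ ∫_0^t (Φ g)(u) du`, the direction in which path functionals are shifted. -/
def shiftPath (H : ℝ) (g : ℝ → ℝ) : ℝ≥0 → ℝ := fun t => ∫ u in (0 : ℝ)..(t : ℝ), Phi H g u

/-- `B` is a fractional Brownian motion with Hurst parameter `H` (continuous version): a centered
Gaussian process with covariance `(s^{2H} + t^{2H} - |s - t|^{2H}) / 2` and continuous paths. -/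
structure IsFBM {Ω : Type*} [MeasurableSpace Ω] (P : Measure Ω) (H : ℝ)
    (B : ℝ≥0 → Ω → ℝ) : Prop where
  measurable : ∀ t, Measurable (B t)
  gaussian : IsGaussianProcess B P
  mean_zero : ∀ t, ∫ ω, B t ω ∂P = 0
  cov_eq : ∀ s t : ℝ≥0, covariance (B s) (B t) P =
    ((s : ℝ) ^ (2 * H) + (t : ℝ) ^ (2 * H) - |(s : ℝ) - (t : ℝ)| ^ (2 * H)) / 2
  continuous_paths : ∀ ω, Continuous fun t => B t ω

/-- `D` is the derivative `D_{Φ g} F` of the random variable `F(B)` in the direction `Φ g`: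
the limit in `L^p(P)`, as `δ → 0`, of
`δ⁻¹ (F (B + δ ∫_0^· (Φ g)(u) du) - F (B))`.
Here `F` is a functional of the path; on the canonical path space, where `B` is the coordinate
process, this is the quotient `δ⁻¹ (F (ω + δ ∫_0^· (Φ g)(u) du) - F ω)`. -/
structure HasPhiDirDeriv {Ω : Type*} [MeasurableSpace Ω] (P : Measure Ω) (H : ℝ)
    (B : ℝ≥0 → Ω → ℝ) (p : ℝ≥0∞) (F : (ℝ≥0 → ℝ) → ℝ) (g : ℝ → ℝ) (D : Ω → ℝ) : Prop where
  memLp : MemLp D p P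
  tendsto : Tendsto
    (fun δ : ℝ => eLpNorm
      (fun ω => δ⁻¹ * (F (fun r => B r ω + δ * shiftPath H g r) - F (fun r => B r ω)) - D ω) p P)
    (𝓝[≠] 0) (𝓝 0)

/-- The random variable `F(B) ∈ L^p` is `φ`-differentiable with `φ`-derivative `(D s)_{s ≥ 0}`:
for every `g ∈ L²_φ`, `D_{Φ g} F = ∫_0^∞ D_s g(s) ds` almost surely. -/
structure IsPhiDerivative {Ω : Type*} [MeasurableSpace Ω] (P : Measure Ω) (H : ℝ)
    (B : ℝ≥0 → Ω → ℝ) (p : ℝ≥0∞) (F : (ℝ≥0 → ℝ) → ℝ) (D : ℝ → Ω → ℝ) : Prop where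
  measurable : Measurable F
  memLp : MemLp (fun ω => F (fun r => B r ω)) p P
  integrableOn : ∀ g, MemL2Phi H g →
    ∀ᵐ ω ∂P, IntegrableOn (fun s => D s ω * g s) (Set.Ioi 0)
  dirDeriv : ∀ g, MemL2Phi H g →
    HasPhiDirDeriv P H B p F g (fun ω => ∫ s in Set.Ioi (0 : ℝ), D s ω * g s)

/-- The process `(F t (B))_{t ≥ 0}` is `φ`-differentiable with `φ`-derivative `D s t = D^φ_s F_t`:
each `F t (B)` is, and `(s, t, ω) ↦ D^φ_s F_t (ω)` is jointly measurable. -/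
structure IsPhiDerivativeProcess {Ω : Type*} [MeasurableSpace Ω] (P : Measure Ω) (H : ℝ)
    (B : ℝ≥0 → Ω → ℝ) (p : ℝ≥0∞) (F : ℝ≥0 → (ℝ≥0 → ℝ) → ℝ) (D : ℝ → ℝ≥0 → Ω → ℝ) : Prop where
  measurable : Measurable fun z : ℝ × ℝ≥0 × Ω => D z.1 z.2.1 z.2.2
  isPhiDerivative : ∀ t, IsPhiDerivative P H B p (F t) (fun s => D s t)

/-- Geometric fractional Brownian motion as a functional of the driving path `w`:
`X_t = x₀ exp (μ t + σ w_t - σ² t^{2H} / 2)`. -/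
def geomFBM (H x₀ μ σ : ℝ) (t : ℝ≥0) (w : ℝ≥0 → ℝ) : ℝ :=
  x₀ * Real.exp (μ * t + σ * w t - σ ^ 2 * (t : ℝ) ^ (2 * H) / 2)

end FracBM

end

/-!
Geometric fractional Brownian motion `X_t` depends on the driving path only through its value at
time `t`, and exponentially so. Shifting the path by `δ ∫_0^· Φ g` therefore multiplies `X_t` by the
deterministic number `exp (σ δ ∫_0^t Φ g)`, and since `X_t` has moments of all orders the directional
derivative exists in every `L^p` and equals `σ X_t ∫_0^t Φ g` (`hasPhiDirDeriv_geomFBM`).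

It remains to write `∫_0^t (Φ g)(u) du` as an integral of `g`. With
`kern H t s = ∫_0^t φ(u, s) du = H (s^(2H-1) + sign (t - s) |t - s|^(2H-1))` for `s ≥ 0`,
Fubini's theorem gives `∫_0^t Φ g = ∫_0^∞ kern H t s g(s) ds` (`MemL2Phi.shiftPath_eq`), so that the
`φ`-derivative is `σ X_t kern H t s`. Fubini requires that `kern H t * g` is integrable. This would
follow from the Cauchy-Schwarz inequality for the scalar product defined by `φ`, but there is a more
elementary reason: `φ(u₀, ·) g` is integrable for some `u₀` as soon as `g` is not almost everywhere
zero, and `kern H t` is bounded by a multiple of `φ(u₀, ·)` (`exists_abs_kern_le_mul_phi`,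
`MemL2Phi.integrableOn_kern_mul`).

For uniqueness, the indicators of `(0, q]` belong to `L²_φ`. By uniqueness of limits in `L^p`, two
`φ`-derivatives almost surely have the same integral over `(0, q]` for all rational `q`, hence they
coincide almost everywhere (`IsPhiDerivative.ae_eq`).
-/

namespace FracBM

/-! ### The primitive of the kernel -/

/-- The odd power `sign x * |x| ^ r`, for `r ≠ 0`. -/
noncomputable def signedPow (r x : ℝ) : ℝ := if 0 ≤ x then x ^ r else -(-x) ^ r

lemma signedPow_of_nonneg {r x : ℝ} (hx : 0 ≤ x) : signedPow r x = x ^ r := if_pos hx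

lemma signedPow_neg {r : ℝ} (hr : 0 < r) (x : ℝ) : signedPow r (-x) = -signedPow r x := by
  rcases lt_trichotomy x 0 with hx | rfl | hx
  · simp [signedPow, hx.le, hx.not_ge]
  · simp [signedPow, Real.zero_rpow hr.ne']
  · simp [signedPow, hx.le, hx.not_ge]

lemma continuous_signedPow {r : ℝ} (hr : 0 < r) : Continuous (signedPow r) := by
  unfold signedPow
  refine Continuous.if_le ?_ ?_ continuous_const continuous_id ?_
  · exact continuous_id.rpow_const fun _ => Or.inr hr.le
  · exact (continuous_id.neg.rpow_const fun _ => Or.inr hr.le).neg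
  · rintro x rfl
    simp [Real.zero_rpow hr.ne']

lemma intervalIntegrable_abs_rpow {r : ℝ} (hr : -1 < r) (a b : ℝ) :
    IntervalIntegrable (fun x : ℝ => |x| ^ r) volume a b := by
  have key : ∀ c, 0 ≤ c → IntervalIntegrable (fun x : ℝ => |x| ^ r) volume 0 c := by
    intro c hc
    refine (intervalIntegral.intervalIntegrable_rpow' hr).congr ?_
    intro x hx
    rw [Set.uIoc_of_le hc] at hx
    simp [abs_of_pos hx.1]
  have key' : ∀ c, IntervalIntegrable (fun x : ℝ => |x| ^ r) volume 0 c := by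
    intro c
    rcases le_total 0 c with hc | hc
    · exact key c hc
    · have := (key (-c) (by linarith)).comp_sub_left 0
      simpa using this
  exact (key' a).symm.trans (key' b)

lemma integral_abs_rpow {r : ℝ} (hr : -1 < r) (a : ℝ) :
    ∫ x in (0 : ℝ)..a, |x| ^ r = signedPow (r + 1) a / (r + 1) := by
  have key : ∀ c, 0 ≤ c → ∫ x in (0 : ℝ)..c, |x| ^ r = c ^ (r + 1) / (r + 1) := by
    intro c hc
    have : ∫ x in (0 : ℝ)..c, |x| ^ r = ∫ x in (0 : ℝ)..c, x ^ r := by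
      refine intervalIntegral.integral_congr fun x hx => ?_
      rw [Set.uIcc_of_le hc] at hx
      simp [abs_of_nonneg hx.1]
    rw [this, integral_rpow (Or.inl hr), Real.zero_rpow (by linarith), sub_zero]
  rcases le_total 0 a with ha | ha
  · rw [key a ha, signedPow_of_nonneg ha]
  · have h := intervalIntegral.integral_comp_neg (a := 0) (b := a) fun x : ℝ => |x| ^ r
    simp only [abs_neg, neg_zero] at h
    rw [h, intervalIntegral.integral_symm, key (-a) (by linarith), ← neg_neg a,
      signedPow_neg (by linarith), signedPow_of_nonneg (by linarith), neg_neg, neg_div]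

/-- `kern H t s = ∫_0^t φ(u, s) du`, in closed form. -/
noncomputable def kern (H t s : ℝ) : ℝ :=
  H * (signedPow (2 * H - 1) s + signedPow (2 * H - 1) (t - s))

variable {H : ℝ}

lemma phi_nonneg (hH : 1 / 2 < H) (s t : ℝ) : 0 ≤ phi H s t := by
  have : 0 < 2 * H - 1 := by linarith
  unfold phi
  positivity

lemma measurable_phi : Measurable fun z : ℝ × ℝ => phi H z.1 z.2 := by
  unfold phi
  fun_prop

lemma measurable_signedPow (r : ℝ) : Measurable (signedPow r) := by
  unfold signedPow
  exact Measurable.ite measurableSet_Ici (by fun_prop) (by fun_prop)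

lemma continuous_kern (hH : 1 / 2 < H) (t : ℝ) : Continuous (kern H t) := by
  have := continuous_signedPow (r := 2 * H - 1) (by linarith)
  unfold kern
  fun_prop

lemma intervalIntegrable_phi (hH : 1 / 2 < H) (s a b : ℝ) :
    IntervalIntegrable (fun u => phi H u s) volume a b := by
  have := (intervalIntegrable_abs_rpow (r := 2 * H - 2) (by linarith) (a - s)
    (b - s)).comp_sub_right s
  simpa [phi] using this.const_mul (H * (2 * H - 1))

lemma integral_phi (hH : 1 / 2 < H) (t s : ℝ) : ∫ u in (0 : ℝ)..t, phi H u s = kern H t s := by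
  have hr : -1 < 2 * H - 2 := by linarith
  have h := intervalIntegral.integral_comp_sub_right (a := 0) (b := t)
    (fun x : ℝ => |x| ^ (2 * H - 2)) s
  simp only [phi, intervalIntegral.integral_const_mul]
  rw [h, ← intervalIntegral.integral_interval_sub_left (intervalIntegrable_abs_rpow hr 0 _)
    (intervalIntegrable_abs_rpow hr 0 _), integral_abs_rpow hr, integral_abs_rpow hr, zero_sub,
    signedPow_neg (by linarith), kern, show 2 * H - 2 + 1 = 2 * H - 1 by ring]
  generalize signedPow (2 * H - 1) (t - s) = a
  generalize signedPow (2 * H - 1) s = b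
  have : 2 * H - 1 ≠ 0 := by linarith
  rw [neg_div, sub_neg_eq_add, ← add_div, mul_assoc, mul_div_cancel₀ _ this, add_comm]

lemma setIntegral_phi (hH : 1 / 2 < H) {t : ℝ} (ht : 0 ≤ t) (s : ℝ) :
    ∫ u in Set.Ioc 0 t, phi H u s = kern H t s := by
  rw [← intervalIntegral.integral_of_le ht, integral_phi hH]

/-- The primitive of the kernel decays at infinity like the kernel itself, and it is bounded near
the singularity of the kernel. -/
lemma exists_abs_kern_le_mul_phi (hH : 1 / 2 < H) (hH' : H < 1) {t : ℝ} (ht : 0 ≤ t) (u₀ : ℝ) :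
    ∃ C, ∀ s, 0 < s → s ≠ u₀ → |kern H t s| ≤ C * phi H u₀ s := by
  have hc : 0 < H * (2 * H - 1) := mul_pos (by linarith) (by linarith)
  have hneg : 2 * H - 2 ≤ 0 := by linarith
  set M : ℝ := |u₀| + 2 * t + 1 with hM
  have hM0 : 0 < M := by positivity
  obtain ⟨K, hK⟩ := (isCompact_Icc (a := (0 : ℝ)) (b := M)).exists_bound_of_continuousOn
    (continuous_kern hH t).continuousOn
  have hK0 : 0 ≤ K := (norm_nonneg _).trans (hK 0 ⟨le_rfl, hM0.le⟩)
  set c₁ : ℝ := H * (2 * H - 1) * (2 * M) ^ (2 * H - 2) with hc₁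
  have hc₁0 : 0 < c₁ := by positivity
  set c₂ : ℝ := t * (1 / 2 : ℝ) ^ (2 * H - 2) with hc₂
  have hc₂0 : 0 ≤ c₂ := by positivity
  refine ⟨K / c₁ + c₂, fun s hs hsu => ?_⟩
  have hphi := phi_nonneg hH u₀ s
  have hdist : 0 < |u₀ - s| := abs_pos.2 (sub_ne_zero.2 hsu.symm)
  rcases le_or_gt s M with hsM | hsM
  · have h1 : |u₀ - s| ≤ 2 * M := by
      have := abs_sub u₀ s
      rw [abs_of_pos hs] at this
      linarith
    have h2 : c₁ ≤ phi H u₀ s :=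
      mul_le_mul_of_nonneg_left (Real.rpow_le_rpow_of_nonpos hdist h1 hneg) hc.le
    calc |kern H t s| ≤ K := hK s ⟨hs.le, hsM⟩
      _ = K / c₁ * c₁ := by field_simp
      _ ≤ K / c₁ * phi H u₀ s := by gcongr
      _ ≤ (K / c₁ + c₂) * phi H u₀ s := by gcongr; linarith
  · -- here `s - u ≥ |u₀ - s| / 2` for every `u ≤ t`
    have h1 : ∀ u ∈ Set.Icc 0 t, phi H u s ≤ (1 / 2 : ℝ) ^ (2 * H - 2) * phi H u₀ s := by
      intro u hu
      have h3 : |u₀ - s| ≤ |u₀| + s := by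
        simpa [abs_of_pos hs] using abs_sub u₀ s
      have h4 : 1 / 2 * |u₀ - s| ≤ |u - s| := by
        rw [abs_sub_comm u s]
        refine le_trans ?_ (le_abs_self _)
        linarith [hu.2]
      have h5 := Real.rpow_le_rpow_of_nonpos (by positivity) h4 hneg
      rw [Real.mul_rpow (by norm_num) hdist.le] at h5
      calc phi H u s ≤ _ := mul_le_mul_of_nonneg_left h5 hc.le
        _ = _ := by rw [phi]; ring
    have h0 : 0 ≤ kern H t s := by
      rw [← integral_phi hH]
      exact intervalIntegral.integral_nonneg ht fun u _ => phi_nonneg hH u s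
    rw [abs_of_nonneg h0]
    calc kern H t s = ∫ u in (0 : ℝ)..t, phi H u s := (integral_phi hH t s).symm
      _ ≤ ∫ u in (0 : ℝ)..t, (1 / 2 : ℝ) ^ (2 * H - 2) * phi H u₀ s :=
        intervalIntegral.integral_mono_on ht (intervalIntegrable_phi hH _ _ _) (by simp) h1
      _ = c₂ * phi H u₀ s := by simp [hc₂]; ring
      _ ≤ (K / c₁ + c₂) * phi H u₀ s := by
        gcongr
        linarith [div_nonneg hK0 hc₁0.le]

/-! ### Exchanging the order of integration -/

/-- By Fubini's theorem `s ↦ φ(u, s) g(u) g(s)` is integrable for almost every `u`. Unless `g = 0`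
almost everywhere, this holds for some `u₀` with `g u₀ ≠ 0`, and the primitive of the kernel is
dominated by `φ(u₀, ·)`. No positive definiteness of `φ` is needed. -/
lemma MemL2Phi.integrableOn_kern_mul (hH : 1 / 2 < H) (hH' : H < 1) {g : ℝ → ℝ}
    (hg : MemL2Phi H g) {t : ℝ} (ht : 0 ≤ t) :
    IntegrableOn (fun s => kern H t s * g s) (Set.Ioi 0) := by
  by_cases h0 : g =ᵐ[volume] 0
  · refine (integrable_zero ℝ ℝ _).congr (ae_restrict_of_ae ?_)
    filter_upwards [h0] with s hs
    simp [hs]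
  obtain ⟨u₀, hu₀, hint⟩ : ∃ u, g u ≠ 0 ∧ Integrable fun s => phi H u s * g u * g s :=
    ((not_eventually.1 h0).and_eventually hg.integrable.prod_right_ae).exists
  have hint' : Integrable fun s => phi H u₀ s * g s := by
    refine (hint.const_mul (g u₀)⁻¹).congr (ae_of_all _ fun s => ?_)
    field_simp
  obtain ⟨C, hC⟩ := exists_abs_kern_le_mul_phi hH hH' ht u₀
  refine (hint'.norm.const_mul C).integrableOn.mono'
    ((continuous_kern hH t).measurable.mul hg.measurable).aestronglyMeasurable ?_
  have hne : ∀ᵐ s : ℝ, s ≠ u₀ := by simp [ae_iff]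
  filter_upwards [ae_restrict_mem measurableSet_Ioi, ae_restrict_of_ae hne] with s hs hsu
  rw [norm_mul, norm_mul, Real.norm_of_nonneg (phi_nonneg hH u₀ s), ← mul_assoc]
  exact mul_le_mul_of_nonneg_right (hC s hs hsu) (norm_nonneg _)

lemma integrable_phi_mul (hH : 1 / 2 < H) {g : ℝ → ℝ} (hg : Measurable g) {t : ℝ} (ht : 0 ≤ t)
    {S : Set ℝ} (hint : IntegrableOn (fun s => kern H t s * g s) S) :
    Integrable (fun z : ℝ × ℝ => phi H z.1 z.2 * g z.2)
      ((volume.restrict (Set.Ioc 0 t)).prod (volume.restrict S)) := by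
  have hmeas : Measurable fun z : ℝ × ℝ => phi H z.1 z.2 * g z.2 :=
    measurable_phi.mul (hg.comp measurable_snd)
  refine (integrable_prod_iff' hmeas.aestronglyMeasurable).2 ⟨?_, ?_⟩
  · exact ae_of_all _ fun s => Integrable.mul_const (f := fun u => phi H u s)
      ((intervalIntegrable_iff_integrableOn_Ioc_of_le ht).1
      (intervalIntegrable_phi hH s 0 t)) (g s)
  · refine hint.norm.congr (ae_of_all _ fun s => ?_)
    have h0 : 0 ≤ kern H t s := by
      rw [← setIntegral_phi hH ht]
      exact integral_nonneg fun u => phi_nonneg hH u s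
    simp only [norm_mul, Real.norm_of_nonneg (phi_nonneg hH _ _), Real.norm_of_nonneg h0]
    rw [integral_mul_const, setIntegral_phi hH ht]

/-- The adjoint relation `∫_0^t Φ g = ∫_0^∞ (Φ 1_{[0,t]}) g`. -/
lemma MemL2Phi.shiftPath_eq (hH : 1 / 2 < H) (hH' : H < 1) {g : ℝ → ℝ} (hg : MemL2Phi H g)
    (t : ℝ≥0) : shiftPath H g t = ∫ s in Set.Ioi (0 : ℝ), kern H t s * g s := by
  simp only [shiftPath, Phi]
  rw [intervalIntegral.integral_of_le t.coe_nonneg]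
  rw [integral_integral_swap (f := fun u s => phi H u s * g s)
    (integrable_phi_mul hH hg.measurable t.coe_nonneg
      (hg.integrableOn_kern_mul hH hH' t.coe_nonneg))]
  simp_rw [integral_mul_const, setIntegral_phi hH t.coe_nonneg]

/-! ### Test functions -/

lemma memL2Phi_indicator_Ioc (hH : 1 / 2 < H) (b : ℝ) :
    MemL2Phi H ((Set.Ioc 0 b).indicator 1) := by
  refine ⟨measurable_one.indicator measurableSet_Ioc, ?_⟩
  rcases le_or_gt b 0 with hb | hb
  · simp [Set.Ioc_eq_empty_of_le hb]
  have h := integrable_phi_mul hH (g := fun _ => 1) measurable_const hb.le (S := Set.Ioc 0 b)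
    (by simpa using (continuous_kern hH b).integrableOn_Ioc)
  rw [Measure.prod_restrict] at h
  refine ((integrable_indicator_iff (measurableSet_Ioc.prod measurableSet_Ioc)).2 h).congr
    (ae_of_all _ fun z => ?_)
  by_cases h1 : z.1 ∈ Set.Ioc 0 b <;> by_cases h2 : z.2 ∈ Set.Ioc 0 b <;>
    simp [Set.indicator, Set.mem_prod, h1, h2]

/-- A function whose integrals over all `(0, q]` with `q` rational vanish is zero almost everywhere:
its primitive is continuous and vanishes on a dense set, and the Lebesgue differentiation theorem
applies. -/
lemma ae_eq_zero_of_forall_rat_integral_eq_zero {f : ℝ → ℝ}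
    (hf : ∀ q : ℚ, IntegrableOn f (Set.Ioc 0 q)) (h0 : ∀ q : ℚ, ∫ s in Set.Ioc 0 (q : ℝ), f s = 0) :
    ∀ᵐ s ∂(volume.restrict (Set.Ioi (0 : ℝ))), f s = 0 := by
  have key : ∀ n : ℕ, ∀ᵐ s, (Set.Ioc 0 (n : ℝ)).indicator f s = 0 := by
    intro n
    have hint : Integrable ((Set.Ioc 0 (n : ℝ)).indicator f) :=
      (integrable_indicator_iff measurableSet_Ioc).2 (by simpa using hf n)
    have hcont : Continuous fun x => ∫ s in (0 : ℝ)..x, (Set.Ioc 0 (n : ℝ)).indicator f s :=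
      intervalIntegral.continuous_primitive (fun a b => hint.intervalIntegrable) 0
    have hzero : (fun x => ∫ s in (0 : ℝ)..x, (Set.Ioc 0 (n : ℝ)).indicator f s) = fun _ => 0 := by
      refine Rat.denseRange_cast.equalizer hcont continuous_const (funext fun q => ?_)
      simp only [Function.comp_apply]
      rcases le_total (q : ℝ) 0 with hq | hq
      · rw [intervalIntegral.integral_of_ge hq, setIntegral_indicator measurableSet_Ioc]
        have : Set.Ioc (q : ℝ) 0 ∩ Set.Ioc 0 (n : ℝ) = ∅ := by
          ext x
          simp only [Set.mem_inter_iff, Set.mem_Ioc, Set.mem_empty_iff_false]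
          grind
        simp [this]
      · rw [intervalIntegral.integral_of_le hq, setIntegral_indicator measurableSet_Ioc,
          Set.Ioc_inter_Ioc]
        simpa using h0 (min q n)
    filter_upwards [LocallyIntegrable.ae_hasDerivAt_integral hint.locallyIntegrable] with x hx
    have := hx 0
    rw [hzero] at this
    exact this.unique (hasDerivAt_const x 0)
  rw [ae_restrict_iff' measurableSet_Ioi]
  filter_upwards [ae_all_iff.2 key] with s hs hs0
  obtain ⟨n, hn⟩ := exists_nat_ge s
  simpa [Set.indicator, Set.mem_Ioc.2 ⟨hs0, hn⟩] using hs n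

variable {Ω : Type*} [MeasurableSpace Ω] {P : Measure Ω} {B : ℝ≥0 → Ω → ℝ} {p : ℝ≥0∞}

/-! ### Limits in `L^p` and the directional derivative -/

lemma measurable_geomFBM (H x₀ μ σ : ℝ) (t : ℝ≥0) : Measurable (geomFBM H x₀ μ σ t) := by
  unfold geomFBM
  fun_prop

/-- Geometric fractional Brownian motion has moments of all orders. -/
lemma memLp_geomFBM (hB : IsFBM P H B) (x₀ μ σ : ℝ) (t : ℝ≥0) (hp : 1 ≤ p) (hp' : p ≠ ∞) :
    MemLp (fun ω => geomFBM H x₀ μ σ t fun r => B r ω) p P := by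
  have hmeas : Measurable fun ω => geomFBM H x₀ μ σ t fun r => B r ω :=
    (measurable_geomFBM H x₀ μ σ t).comp (measurable_pi_lambda _ hB.measurable)
  have hgauss := (hB.gaussian.hasGaussianLaw_eval t).map_eq_gaussianReal
  have hint : Integrable (fun ω => Real.exp (p.toReal * σ * B t ω)) P := by
    have h := integrable_exp_mul_gaussianReal (μ := ∫ ω, B t ω ∂P)
      (v := (variance (B t) P).toNNReal) (p.toReal * σ)
    rw [← hgauss] at h
    exact h.comp_measurable (hB.measurable t)
  have hp0 : p ≠ 0 := (zero_lt_one.trans_le hp).ne'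
  rw [← integrable_norm_rpow_iff hmeas.aestronglyMeasurable hp0 hp']
  refine (hint.const_mul (|x₀| ^ p.toReal *
    Real.exp (p.toReal * (μ * t - σ ^ 2 * (t : ℝ) ^ (2 * H) / 2)))).congr (ae_of_all _ fun ω => ?_)
  simp only [geomFBM]
  rw [norm_mul, Real.norm_eq_abs, Real.norm_of_nonneg (Real.exp_pos _).le,
    Real.mul_rpow (abs_nonneg _) (Real.exp_pos _).le, ← Real.exp_mul, mul_assoc, ← Real.exp_add]
  ring_nf

/-- A shift of the path multiplies `X_t` by the deterministic factor `exp (σ δ h t)`, so the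
convergence in `L^p` of the difference quotients is that of a numerical sequence. -/
lemma hasPhiDirDeriv_geomFBM (hB : IsFBM P H B) (x₀ μ σ : ℝ) (t : ℝ≥0) (hp : 1 ≤ p) (hp' : p ≠ ∞)
    (g : ℝ → ℝ) :
    HasPhiDirDeriv P H B p (geomFBM H x₀ μ σ t) g
      (fun ω => σ * shiftPath H g t * geomFBM H x₀ μ σ t fun r => B r ω) := by
  have hX := memLp_geomFBM hB x₀ μ σ t hp hp'
  refine ⟨hX.const_mul _, ?_⟩
  set c := σ * shiftPath H g t with hc
  have heq : ∀ δ : ℝ, (fun ω => δ⁻¹ * (geomFBM H x₀ μ σ t (fun r => B r ω + δ * shiftPath H g r) -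
      geomFBM H x₀ μ σ t fun r => B r ω) - c * geomFBM H x₀ μ σ t fun r => B r ω) =
      (δ⁻¹ * (Real.exp (c * δ) - 1) - c) • fun ω => geomFBM H x₀ μ σ t fun r => B r ω := by
    intro δ
    ext ω
    have : μ * t + σ * (B t ω + δ * shiftPath H g t) - σ ^ 2 * (t : ℝ) ^ (2 * H) / 2 =
        (μ * t + σ * B t ω - σ ^ 2 * (t : ℝ) ^ (2 * H) / 2) + c * δ := by
      rw [hc]; ring
    simp only [geomFBM, Pi.smul_apply, smul_eq_mul]
    rw [this, Real.exp_add]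
    ring
  simp_rw [heq, eLpNorm_const_smul]
  have hderiv : HasDerivAt (fun δ : ℝ => Real.exp (c * δ)) c 0 := by
    simpa using ((hasDerivAt_id (0 : ℝ)).const_mul c).exp
  have hlim : Tendsto (fun δ : ℝ => δ⁻¹ * (Real.exp (c * δ) - 1) - c) (𝓝[≠] 0) (𝓝 0) := by
    have := hderiv.tendsto_slope_zero.sub_const c
    simpa using this
  have hlim' := hlim.enorm
  rw [enorm_zero] at hlim'
  simpa using ENNReal.Tendsto.mul_const hlim' (Or.inr hX.eLpNorm_ne_top)

/-- Limits in `L^p` are unique up to null sets. -/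
lemma HasPhiDirDeriv.ae_eq (hB : IsFBM P H B) {F : (ℝ≥0 → ℝ) → ℝ} (hF : Measurable F)
    (hp : 1 ≤ p) {g : ℝ → ℝ} {D₁ D₂ : Ω → ℝ} (h₁ : HasPhiDirDeriv P H B p F g D₁)
    (h₂ : HasPhiDirDeriv P H B p F g D₂) : D₁ =ᵐ[P] D₂ := by
  set Q : ℝ → Ω → ℝ := fun δ ω =>
    δ⁻¹ * (F (fun r => B r ω + δ * shiftPath H g r) - F (fun r => B r ω)) with hQ
  have hQm : ∀ δ, AEStronglyMeasurable (Q δ) P := fun δ => by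
    have m₁ : Measurable fun ω => F (fun r => B r ω + δ * shiftPath H g r) :=
      hF.comp (measurable_pi_lambda _ fun r => (hB.measurable r).add_const _)
    have m₂ : Measurable fun ω => F (fun r => B r ω) :=
      hF.comp (measurable_pi_lambda _ hB.measurable)
    exact ((m₁.sub m₂).const_mul _).aestronglyMeasurable
  have hle : ∀ δ, eLpNorm (D₁ - D₂) p P ≤ eLpNorm (Q δ - D₁) p P + eLpNorm (Q δ - D₂) p P := by
    intro δ
    have : D₁ - D₂ = (Q δ - D₂) - (Q δ - D₁) := by abel
    rw [this, add_comm]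
    exact eLpNorm_sub_le ((hQm δ).sub h₂.memLp.1) ((hQm δ).sub h₁.memLp.1) hp
  have hzero : eLpNorm (D₁ - D₂) p P = 0 := by
    have hsum := h₁.tendsto.add h₂.tendsto
    rw [add_zero] at hsum
    exact le_antisymm (ge_of_tendsto' hsum hle) bot_le
  rw [eLpNorm_eq_zero_iff (h₁.memLp.1.sub h₂.memLp.1) (zero_lt_one.trans_le hp).ne'] at hzero
  filter_upwards [hzero] with ω hω
  simpa [sub_eq_zero] using hω

/-- Two `φ`-derivatives of the same random variable agree: tested against the indicators of
`(0, q]` with `q` rational they have the same integrals, outside a single null set. -/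
lemma IsPhiDerivative.ae_eq (hH : 1 / 2 < H) (hB : IsFBM P H B) (hp : 1 ≤ p)
    {F : (ℝ≥0 → ℝ) → ℝ} {D₁ D₂ : ℝ → Ω → ℝ} (h₁ : IsPhiDerivative P H B p F D₁)
    (h₂ : IsPhiDerivative P H B p F D₂) :
    ∀ᵐ ω ∂P, ∀ᵐ s ∂(volume.restrict (Set.Ioi (0 : ℝ))), D₁ s ω = D₂ s ω := by
  have hg := fun q : ℚ => memL2Phi_indicator_Ioc hH (q : ℝ)
  have hint₁ := ae_all_iff.2 fun q => h₁.integrableOn _ (hg q)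
  have hint₂ := ae_all_iff.2 fun q => h₂.integrableOn _ (hg q)
  have heq := ae_all_iff.2 fun q =>
    (h₁.dirDeriv _ (hg q)).ae_eq hB h₁.measurable hp (h₂.dirDeriv _ (hg q))
  filter_upwards [hint₁, hint₂, heq] with ω i₁ i₂ e
  have hrw : ∀ (D : ℝ → Ω → ℝ) (q : ℚ), (fun s => D s ω * (Set.Ioc 0 (q : ℝ)).indicator 1 s) =
      (Set.Ioc 0 (q : ℝ)).indicator fun s => D s ω := by
    intro D q
    ext s
    by_cases hs : s ∈ Set.Ioc 0 (q : ℝ) <;> simp [hs]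
  have hinter : ∀ q : ℚ, Set.Ioc 0 (q : ℝ) ∩ Set.Ioi 0 = Set.Ioc 0 (q : ℝ) := fun q =>
    Set.inter_eq_left.2 fun s hs => hs.1
  simp only [hrw, IntegrableOn, integrable_indicator_iff measurableSet_Ioc,
    Measure.restrict_restrict measurableSet_Ioc, hinter] at i₁ i₂
  simp only [hrw, integral_indicator measurableSet_Ioc,
    Measure.restrict_restrict measurableSet_Ioc, hinter] at e
  have := ae_eq_zero_of_forall_rat_integral_eq_zero (f := fun s => D₁ s ω - D₂ s ω)
    (fun q => (i₁ q).sub (i₂ q)) fun q => by rw [integral_sub (i₁ q) (i₂ q), e q, sub_self]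
  filter_upwards [this] with s hs
  exact sub_eq_zero.1 hs

/-! ### The `φ`-derivative of geometric fractional Brownian motion -/

/-- The `φ`-derivative `σ X_t ∫_0^t φ(s, u) du` of geometric fractional Brownian motion. -/
noncomputable def geomFBMDeriv (H x₀ μ σ : ℝ) (B : ℝ≥0 → Ω → ℝ) (s : ℝ) (t : ℝ≥0) (ω : Ω) : ℝ :=
  σ * geomFBM H x₀ μ σ t (fun r => B r ω) * kern H t s

lemma measurable_geomFBMDeriv (hB : IsFBM P H B) (x₀ μ σ : ℝ) :
    Measurable fun z : ℝ × ℝ≥0 × Ω => geomFBMDeriv H x₀ μ σ B z.1 z.2.1 z.2.2 := by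
  have hBm : Measurable fun z : ℝ × ℝ≥0 × Ω => B z.2.1 z.2.2 :=
    (measurable_uncurry_of_continuous_of_measurable hB.continuous_paths hB.measurable).comp
      measurable_snd
  have h₁ := (measurable_signedPow (2 * H - 1)).comp
    (measurable_fst : Measurable fun z : ℝ × ℝ≥0 × Ω => z.1)
  have h₂ := (measurable_signedPow (2 * H - 1)).comp
    (by fun_prop : Measurable fun z : ℝ × ℝ≥0 × Ω => (z.2.1 : ℝ) - z.1)
  have ht : Measurable fun z : ℝ × ℝ≥0 × Ω => (z.2.1 : ℝ) := by fun_prop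
  have h₃ := ((ht.const_mul μ).add (hBm.const_mul σ)).sub
    (((ht.pow_const (2 * H)).const_mul (σ ^ 2)).div_const 2)
  exact ((h₃.exp.const_mul x₀).const_mul σ).mul ((h₁.add h₂).const_mul H)

lemma isPhiDerivative_geomFBM (hH : 1 / 2 < H) (hH' : H < 1) (hB : IsFBM P H B) (x₀ μ σ : ℝ)
    (t : ℝ≥0) (hp : 1 ≤ p) (hp' : p ≠ ∞) :
    IsPhiDerivative P H B p (geomFBM H x₀ μ σ t) fun s => geomFBMDeriv H x₀ μ σ B s t where
  measurable := measurable_geomFBM H x₀ μ σ t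
  memLp := memLp_geomFBM hB x₀ μ σ t hp hp'
  integrableOn g hg := ae_of_all _ fun ω => by
    simp only [geomFBMDeriv, mul_assoc _ (kern H _ _)]
    exact (hg.integrableOn_kern_mul hH hH' t.coe_nonneg).const_mul _
  dirDeriv g hg := by
    convert hasPhiDirDeriv_geomFBM hB x₀ μ σ t hp hp' g using 2 with ω
    simp only [geomFBMDeriv, mul_assoc _ (kern H _ _)]
    rw [integral_const_mul, hg.shiftPath_eq hH hH']
    ring

end FracBM

theorem mainTheorem8 {Ω : Type*} [MeasurableSpace Ω] (P : Measure Ω) [IsProbabilityMeasure P]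
    (H : ℝ) (hH : 1 / 2 < H) (hH' : H < 1) (B : ℝ≥0 → Ω → ℝ) (hB : FracBM.IsFBM P H B)
    (x₀ μ σ : ℝ) (hx₀ : 0 ≤ x₀) :
    ∃ D : ℝ → ℝ≥0 → Ω → ℝ,
      (∀ p : ℝ≥0∞, 1 ≤ p → p ≠ ∞ →
        FracBM.IsPhiDerivativeProcess P H B p (FracBM.geomFBM H x₀ μ σ) D) ∧
      (∀ (s : ℝ) (t : ℝ≥0) (ω : Ω), 0 ≤ s → s ≤ t →
        D s t ω = σ * H * FracBM.geomFBM H x₀ μ σ t (fun r => B r ω) *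
          (s ^ (2 * H - 1) + ((t : ℝ) - s) ^ (2 * H - 1))) ∧
      (∀ (s : ℝ) (t : ℝ≥0) (ω : Ω), (t : ℝ) ≤ s →
        D s t ω = σ * H * FracBM.geomFBM H x₀ μ σ t (fun r => B r ω) *
          (s ^ (2 * H - 1) - (s - (t : ℝ)) ^ (2 * H - 1))) ∧
      (∀ p : ℝ≥0∞, 1 ≤ p → p ≠ ∞ → ∀ (t : ℝ≥0) (D' : ℝ → Ω → ℝ),
        FracBM.IsPhiDerivative P H B p (FracBM.geomFBM H x₀ μ σ t) D' →
          ∀ᵐ ω ∂P, ∀ᵐ s ∂(volume.restrict (Set.Ioi (0 : ℝ))), D' s ω = D s t ω) := by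
  refine ⟨FracBM.geomFBMDeriv H x₀ μ σ B, fun p hp hp' => ?_, fun s t ω hs hst => ?_,
    fun s t ω hts => ?_, fun p hp hp' t D' hD' => ?_⟩
  · exact ⟨FracBM.measurable_geomFBMDeriv hB x₀ μ σ,
      fun t => FracBM.isPhiDerivative_geomFBM hH hH' hB x₀ μ σ t hp hp'⟩
  · rw [FracBM.geomFBMDeriv, FracBM.kern, FracBM.signedPow_of_nonneg hs,
      FracBM.signedPow_of_nonneg (sub_nonneg.2 hst)]
    ring
  · rw [FracBM.geomFBMDeriv, FracBM.kern, FracBM.signedPow_of_nonneg (t.coe_nonneg.trans hts),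
      ← neg_sub s (t : ℝ), FracBM.signedPow_neg (by linarith),
      FracBM.signedPow_of_nonneg (sub_nonneg.2 hts)]
    ring
  · exact hD'.ae_eq hH hB hp (FracBM.isPhiDerivative_geomFBM hH hH' hB x₀ μ σ t hp hp')
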